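/- Conventions. A simplicial complex $K$ on a finite set $V$ is a family of subsets of $V$ that contains $\varnothing$ and is closed under taking subsets; elements $v\in V$ with $\{v\}\notin K$ are allowed. $K$ is \emph{flag} if all its minimal non-faces have cardinality at most $2$. Let $n=\dim K+1$ be the largest cardinality of a face and let $f_{i-1}(K)$ be the number of faces of cardinality $i$ (so $f_{-1}=1$). The $h$-vector $(h_0,\dots,h_n)$ is defined by $$\sum_{i=0}^{n} h_i t^{n-i}=\sum_{i=0}^{n} f_{i-1}(t-1)^{n-i},$$ and a $\gamma$-vector of $K$ is a vector $(\gamma_0,\dots,\gamma_{\lfloor n/2\rfloor})$ of integers with $$\sum_{i=0}^{n} h_i t^{i}=\sum_{i=0}^{\lfloor n/2\rfloor}\gamma_i\, t^i(1+t)^{n-2i}.$$ Let $c=(c_1,\dots,c_m)$ be a vector of positive integers. A \emph{$c$-multicomplex} is a non-empty set $M$ of monomials $x^a=x_1^{a_1}\cdots x_m^{a_m}$ with $0\le a_i\le c_i$ for all $i$ that contains every divisor of each of its elements; it is \emph{proper} if it is not the set of all such monomials. For a proper $c$-multicomplex $M$, the \emph{Murai sphere} $\mathrm{Bier}_c(M)$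 is the simplicial complex on $\tilde X=\{x_i^{(j)} : 1\le i\le m,\ 0\le j\le c_i\}$ generated by the sets $$\bigl(\tilde X\setminus\{x_1^{(a_1)},\dots,x_m^{(a_m)}\}\bigr)\setminus\{x_i^{(j)}\},$$ where $x^a\in M$, $1\le i\le m$, $a_i<j\le c_i$, and the monomial obtained from $x^a$ by replacing the exponent $a_i$ of $x_i$ by $j$ is not in $M$. \textbf{Corollary.} Flag Murai spheres satisfy the Nevo--Petersen conjecture: for every vector $c$ of positive integers and every proper $c$-multicomplex $M$ such that $\mathrm{Bier}_c(M)$ is flag, the complex $\mathrm{Bier}_c(M)$ has a (unique) $\gamma$-vector $(\gamma_0,\dots,\gamma_{\lfloor n/2\rfloor})$, and this $\gamma$-vector is the $f$-vector of a flag simplicial complex; that is, there is a flag simplicial complex $L$ on a finite set with $f_{i-1}(L)=\gamma_i$ for $0\le i\le\lfloor n/2\rfloor$ and $f_{i-1}(L)=0$ for $i>\lfloor n/2\rfloor$. -/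

import Mathlib

/-- An abstract simplicial complex on the vertex set `V`: a family of finite subsets of `V` that
contains the empty set and is closed under taking subsets. Elements `v` of `V` such that `{v}` is
not a face (ghost vertices) are allowed. All numerical invariants below are meant for finite `V`. -/
structure SimplicialComplexOn (V : Type*) where
  faces : Set (Finset V)
  empty_mem : ∅ ∈ faces
  down_closed : ∀ ⦃s t : Finset V⦄, s ∈ faces → t ⊆ s → t ∈ faces

namespace SimplicialComplexOn

variable {V : Type*}

/-- A minimal non-face: a non-face all of whose proper subsets are faces. -/
def IsMinimalNonface (K : SimplicialComplexOn V) (s : Finset V) : Prop :=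
  Minimal (fun t => t ∉ K.faces) s

/-- A complex is flag if its minimal non-faces have cardinality at most two. -/
def IsFlag (K : SimplicialComplexOn V) : Prop :=
  ∀ s : Finset V, K.IsMinimalNonface s → s.card ≤ 2

/-- The largest cardinality of a face, that is, `dim K + 1`. -/
noncomputable def rank (K : SimplicialComplexOn V) : ℕ :=
  sSup (Finset.card '' K.faces)

/-- `K.fVector i` is the number of faces of cardinality `i`, that is, the entry `f_{i-1}` of the
`f`-vector; it vanishes for `i > dim K + 1`. -/
noncomputable def fVector (K : SimplicialComplexOn V) (i : ℕ) : ℕ :=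
  {s : Finset V | s ∈ K.faces ∧ s.card = i}.ncard

open Polynomial in
/-- The polynomial `(t-1)^n + f_0 (t-1)^(n-1) + ⋯ + f_{n-1}`, where `n = dim K + 1`. -/
noncomputable def shiftedFPolynomial (K : SimplicialComplexOn V) : ℤ[X] :=
  ∑ i ∈ Finset.range (K.rank + 1), C (K.fVector i : ℤ) * (X - 1) ^ (K.rank - i)

/-- The entry `h_k` of the `h`-vector, for `0 ≤ k ≤ n = dim K + 1`, defined by
`h_0 t^n + ⋯ + h_{n-1} t + h_n = (t-1)^n + f_0 (t-1)^(n-1) + ⋯ + f_{n-1}`. -/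
noncomputable def hVector (K : SimplicialComplexOn V) (k : Fin (K.rank + 1)) : ℤ :=
  K.shiftedFPolynomial.coeff (K.rank - k)

open Polynomial in
/-- `γ` is the `γ`-vector `(γ_0, …, γ_{⌊n/2⌋})` of `K`, where `n = dim K + 1`, continued by zeros:
`h_0 + h_1 t + ⋯ + h_n t^n = ∑_{i ≤ n/2} γ_i t^i (1+t)^(n-2i)`. -/
def IsGammaVector (K : SimplicialComplexOn V) (γ : ℕ → ℤ) : Prop :=
  (∀ i, K.rank / 2 < i → γ i = 0) ∧
    ∑ k : Fin (K.rank + 1), C (K.hVector k) * X ^ (k : ℕ) =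
      ∑ i ∈ Finset.range (K.rank / 2 + 1), C (γ i) * X ^ i * (1 + X) ^ (K.rank - 2 * i)

end SimplicialComplexOn

/-- A `c`-multicomplex: a non-empty set of monomials `x^a` in `m` variables with `a ≤ c`, closed
under passing to divisors. The monomial `x^a` is represented by its exponent vector `a`, so that
divisibility is the componentwise order. -/
structure Multicomplex {m : ℕ} (c : Fin m → ℕ) where
  monomials : Set (Fin m → ℕ)
  nonempty : monomials.Nonempty
  le_bound : ∀ a ∈ monomials, a ≤ c
  down_closed : ∀ ⦃a b : Fin m → ℕ⦄, a ∈ monomials → b ≤ a → b ∈ monomials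

namespace Multicomplex

variable {m : ℕ} {c : Fin m → ℕ}

/-- A `c`-multicomplex is proper if it is not the set of all `c`-monomials. -/
def IsProper (M : Multicomplex c) : Prop :=
  M.monomials ≠ {a | a ≤ c}

/-- The ground set of the Murai sphere: the points `x_i^{(j)}` with `0 ≤ j ≤ c_i`. -/
abbrev Vertex (c : Fin m → ℕ) : Type :=
  Σ i : Fin m, Fin (c i + 1)

/-- The set `F_c(x^a)`: all `x_i^{(j)}` except `x_1^{(a_1)}, …, x_m^{(a_m)}`. -/
def F (c : Fin m → ℕ) (a : Fin m → ℕ) : Finset (Vertex c) :=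
  Finset.univ.filter fun v => (v.2 : ℕ) ≠ a v.1

/-- The sets `F_c(x^a) \ {x_i^{(j)}}` with `x^a ∈ M`, `a_i < j ≤ c_i`, and such that the monomial
obtained from `x^a` by replacing the exponent `a_i` by `j` is not in `M`. -/
def bierFacets (M : Multicomplex c) : Set (Finset (Vertex c)) :=
  {s | ∃ a ∈ M.monomials, ∃ (i : Fin m) (j : Fin (c i + 1)),
    a i < (j : ℕ) ∧ Function.update a i (j : ℕ) ∉ M.monomials ∧ s = F c a \ {⟨i, j⟩}}

theorem bierFacets_nonempty (M : Multicomplex c) (hM : M.IsProper) : M.bierFacets.Nonempty := by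
  have hfin : M.monomials.Finite := (Set.finite_Iic c).subset M.le_bound
  obtain ⟨a, ha⟩ := hfin.exists_maximal M.nonempty
  have hne : a ≠ c := by
    rintro rfl
    exact hM (Set.Subset.antisymm M.le_bound fun b hb => M.down_closed ha.prop hb)
  obtain ⟨i, hi⟩ : ∃ i, a i ≠ c i := Function.ne_iff.mp hne
  have hlt : a i < c i := lt_of_le_of_ne (M.le_bound a ha.prop i) hi
  refine ⟨_, a, ha.prop, i, ⟨a i + 1, by omega⟩, Nat.lt_succ_self _, fun hmem => ?_, rfl⟩
  have hle : a ≤ Function.update a i (a i + 1) := by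
    intro k
    by_cases hk : k = i
    · subst hk; simp
    · simp [hk]
  have h := ha.le_of_ge hmem hle i
  simp at h

/-- The Murai sphere (generalized Bier sphere) `Bier_c(M)` of a proper `c`-multicomplex `M`: the
simplicial complex generated by the facets above. -/
def bier (M : Multicomplex c) (hM : M.IsProper) : SimplicialComplexOn (Vertex c) where
  faces := {s | ∃ t ∈ M.bierFacets, s ⊆ t}
  empty_mem := by
    obtain ⟨t, ht⟩ := M.bierFacets_nonempty hM
    exact ⟨t, ht, Finset.empty_subset t⟩
  down_closed := by
    rintro s u ⟨t, ht, hst⟩ hus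
    exact ⟨t, ht, hus.trans hst⟩

end Multicomplex

/-!
The key point is that a flag Murai sphere is, up to suspension, of dimension at most two, so that
its `γ`-vector is `(1, γ_1, 0, …, 0)`, and that `γ_1 = f_0 - 2n` is nonnegative; the `γ`-vector is
then the `f`-vector of `γ_1` isolated points.

**Faces.** A set `s` of vertices is a face if and only if its complement contains the points of an
element of `M` and the points of a `c`-monomial outside `M` (`mem_faces_bier_iff`). Hence the
minimal `c`-monomials `x^b` outside `M` and the maximal elements `x^a` of `M` give minimal non-faces
of cardinality `|b|` and `|c| - |a|`, and in the flag case these numbers are at most two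
(`hasSmallGenerators_of_isFlag`, `hasSmallCodegree_of_isFlag`).

**Essential variables.** Call a variable essential if membership in `M` depends on it. Flagness
forces `c_i = 1` for the inessential variables (`bound_eq_one_of_not_isEssential`). If `x^a ∈ M` has
codegree at most two, a pigeonhole argument shows that its essential part has degree at most two;
hence the essential part of `x^c` has degree `D ≤ 4` (`sum_bound_le_four`).

**The `h`-polynomial.** Sorting the complements of faces by their highest and lowest points gives
`(t - 1) h(t) = ∑ (t^{|v|} - t^{|c|-|v|})`, the sum being over the `c`-monomials `x^v` outside `M`
(`mul_shiftedFPolynomial_bier`; as `h` is palindromic, its reversal in the definition is harmless).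
Every inessential variable contributes a factor `1 + t`, and what remains of `h` is palindromic of
degree `D - 1 ≤ 3` with constant term one. Therefore `h = (1 + t)^n + g t (1 + t)^{n-2}` for an
integer `g` (`exists_shiftedFPolynomial_bier_eq`), and comparison of coefficients yields
`g = f_0 - 2n`.

**Nonnegativity.** Fix a facet `s`. Each ridge `s \ {x}` lies in another facet, spanned with a
vertex `y(x)` outside `s`. If `y(x) = y(x')` for distinct `x`, `x'`, the only possible non-edge in
`s ∪ {y(x)}` would be `{x, x'} ⊆ s`, so by flagness `s ∪ {y(x)}` would be a face, which is too
large. Hence `f_0 ≥ 2n` (`two_mul_rank_le_fVector_one`).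
-/

/-! ### Essential variables of a multicomplex -/

namespace Multicomplex

variable {m : ℕ} {c : Fin m → ℕ}

/-- A variable `x_i` is essential if it divides a `c`-monomial of degree at most two that is minimal
outside `M`: this monomial is `x_i` itself or a product `x_i x_k`, where `k = i` is possible.
Minimality of the product also requires `x_i ∈ M`, but otherwise the first alternative holds. -/
def IsEssential (M : Multicomplex c) (i : Fin m) : Prop :=
  Pi.single i 1 ∉ M.monomials ∨ ∃ k, (Pi.single k 1 : Fin m → ℕ) ∈ M.monomials ∧
    Pi.single i 1 + Pi.single k 1 ≤ c ∧ Pi.single i 1 + Pi.single k 1 ∉ M.monomials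

theorem zero_mem (M : Multicomplex c) : (0 : Fin m → ℕ) ∈ M.monomials := by
  obtain ⟨a, ha⟩ := M.nonempty
  exact M.down_closed ha (fun i => Nat.zero_le _)

theorem single_add_single_le {i k : Fin m} {a : Fin m → ℕ} (hi : 1 ≤ a i) (hk : 1 ≤ a k)
    (h : i = k → 2 ≤ a i) : Pi.single i 1 + Pi.single k 1 ≤ a := by
  intro j
  have h' : i = j → k = j → 2 ≤ a j := fun h1 h2 => h1 ▸ h (h1.trans h2.symm)
  have hi' : i = j → 1 ≤ a j := fun h1 => h1 ▸ hi
  have hk' : k = j → 1 ≤ a j := fun h1 => h1 ▸ hk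
  simp only [Pi.add_apply, Pi.single_apply, eq_comm (a := j)]
  split_ifs <;> simp_all

theorem one_le_of_single_le {i : Fin m} {a : Fin m → ℕ} (h : Pi.single i 1 ≤ a) : 1 ≤ a i := by
  simpa using h i

theorem single_le {i : Fin m} {a : Fin m → ℕ} (h : 1 ≤ a i) : Pi.single i 1 ≤ a := by
  intro j
  rcases eq_or_ne j i with rfl | hj <;> simp [*]

/-- An essential variable dividing an element `x^a` of `M` has a partner: a variable whose exponent
in `x^a` cannot be raised without leaving `M`. -/
theorem IsEssential.exists_partner {M : Multicomplex c} {i : Fin m} (hi : M.IsEssential i)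
    {a : Fin m → ℕ} (ha : a ∈ M.monomials) (hai : 1 ≤ a i) :
    ∃ k, (Pi.single k 1 : Fin m → ℕ) ∈ M.monomials ∧ Pi.single i 1 + Pi.single k 1 ≤ c ∧
      Pi.single i 1 + Pi.single k 1 ∉ M.monomials ∧ (k = i ∧ a i = 1 ∨ k ≠ i ∧ a k = 0) := by
  rcases hi with hi | ⟨k, hk, hle, hnot⟩
  · exact absurd (M.down_closed ha (single_le hai)) hi
  · refine ⟨k, hk, hle, hnot, ?_⟩
    by_contra! hcon
    refine hnot (M.down_closed ha ?_)
    rcases eq_or_ne k i with rfl | hki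
    · have := hcon.1 rfl
      exact single_add_single_le hai hai fun _ => by omega
    · have := hcon.2 hki
      exact single_add_single_le hai (by omega) fun h => absurd h.symm hki

theorem add_le_of_sum_le {f : Fin m → ℕ} {N : ℕ} (h : ∑ i, f i ≤ N) {i j : Fin m}
    (hij : j ≠ i) : f i + f j ≤ N := by
  have := Finset.sum_le_sum_of_subset (f := f) (Finset.subset_univ {i, j})
  rw [Finset.sum_pair hij.symm] at this
  omega

theorem add_add_le_of_sum_le {f : Fin m → ℕ} {N : ℕ} (h : ∑ i, f i ≤ N) {i j k : Fin m}
    (hij : i ≠ j) (hik : i ≠ k) (hjk : j ≠ k) : f i + f j + f k ≤ N := by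
  have := Finset.sum_le_sum_of_subset (f := f) (Finset.subset_univ {i, j, k})
  rw [Finset.sum_insert (by simp [hij, hik]), Finset.sum_pair hjk] at this
  omega

/-- Every element of `M` divides an element whose codegree in `x^c` is at most two. -/
def HasSmallCodegree (M : Multicomplex c) : Prop :=
  ∀ a ∈ M.monomials, ∃ a' ∈ M.monomials, a ≤ a' ∧ ∑ i, (c i - a' i) ≤ 2

/-- If `x_i^2 ∣ x^a` for an essential variable `x_i`, no other essential variable divides `x^a`. -/
theorem HasSmallCodegree.eq_two {M : Multicomplex c} (hM : M.HasSmallCodegree)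
    {a : Fin m → ℕ} (ha : a ∈ M.monomials) {i : Fin m} (hi : M.IsEssential i) (hai : 2 ≤ a i) :
    a i ≤ 2 ∧ ∀ j, M.IsEssential j → j ≠ i → a j = 0 := by
  obtain ⟨k, hk, -, hnot, hcase⟩ := hi.exists_partner ha (by omega)
  obtain ⟨hki, -⟩ : k ≠ i ∧ a k = 0 := by
    rcases hcase with h | h
    · omega
    · exact h
  obtain ⟨a', ha', hle, hsum⟩ := hM _ hk
  have hk1 := one_le_of_single_le hle
  have hi0 : a' i = 0 := by
    by_contra h
    exact hnot (M.down_closed ha' (single_add_single_le (by omega) hk1 fun h => absurd h.symm hki))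
  have hci : a i ≤ c i := M.le_bound a ha i
  have hsi := Finset.single_le_sum (f := fun i => c i - a' i) (fun _ _ => Nat.zero_le _)
    (Finset.mem_univ i)
  simp only [hi0] at hsi
  refine ⟨by omega, fun j hj hji => ?_⟩
  by_contra haj
  obtain ⟨l, -, hlc, hlnot, hlcase⟩ := hj.exists_partner ha (by omega)
  refine hlnot (M.down_closed ha' fun p => ?_)
  rcases eq_or_ne p i with rfl | hpi
  · have hlp : l ≠ p := by
      rintro rfl
      rcases hlcase with h | h
      · exact hji h.1.symm
      · omega
    simp [hji.symm, hlp.symm]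
  · have := add_le_of_sum_le hsum hpi
    simp only [hi0] at this
    exact (hlc p).trans (show c p ≤ a' p by omega)

/-- Two distinct essential variables dividing `x^a` cannot share a partner when `x^a` is divisible
by a third essential variable. -/
theorem HasSmallCodegree.false_of_common_partner {M : Multicomplex c} (hM : M.HasSmallCodegree)
    {a : Fin m → ℕ} (ha : a ∈ M.monomials) {i j l k q : Fin m} (hij : i ≠ j) (hil : i ≠ l)
    (hjl : j ≠ l) (hai : 1 ≤ a i) (haj : 1 ≤ a j)
    (hk : (Pi.single k 1 : Fin m → ℕ) ∈ M.monomials)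
    (hik : Pi.single i 1 + Pi.single k 1 ∉ M.monomials)
    (hjk : Pi.single j 1 + Pi.single k 1 ∉ M.monomials)
    (hiq : k = i ∧ a i = 1 ∨ k ≠ i ∧ a k = 0) (hjq : k = j ∧ a j = 1 ∨ k ≠ j ∧ a k = 0)
    (hlqc : Pi.single l 1 + Pi.single q 1 ≤ c)
    (hlq : Pi.single l 1 + Pi.single q 1 ∉ M.monomials)
    (hlqa : q = l ∧ a l = 1 ∨ q ≠ l ∧ a q = 0) : False := by
  have hki : k ≠ i := by
    rintro rfl
    rcases hjq with h | h
    · exact hij h.1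
    · omega
  have hkj : k ≠ j := by
    rintro rfl
    rcases hiq with h | h
    · exact hij h.1.symm
    · omega
  obtain ⟨a', ha', hle, hsum⟩ := hM _ hk
  have hk1 := one_le_of_single_le hle
  have hi0 : a' i = 0 := by
    by_contra h
    exact hik (M.down_closed ha' (single_add_single_le (by omega) hk1 fun h => absurd h.symm hki))
  have hj0 : a' j = 0 := by
    by_contra h
    exact hjk (M.down_closed ha' (single_add_single_le (by omega) hk1 fun h => absurd h.symm hkj))
  have hci : a i ≤ c i := M.le_bound a ha i
  have hcj : a j ≤ c j := M.le_bound a ha j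
  have hq : ∀ p, 1 ≤ a p → l ≠ p → q ≠ p := by
    rintro p hp hlp rfl
    rcases hlqa with h | h
    · exact hlp h.1.symm
    · omega
  refine hlq (M.down_closed ha' fun p => ?_)
  rcases eq_or_ne p i with rfl | hpi
  · simp [hil, (hq p hai hil.symm).symm]
  rcases eq_or_ne p j with rfl | hpj
  · simp [hjl, (hq p haj hjl.symm).symm]
  have := add_add_le_of_sum_le hsum hij hpi.symm hpj.symm
  simp only [hi0, hj0] at this
  exact (hlqc p).trans (show c p ≤ a' p by omega)

open Classical in
/-- The essential part of an element of codegree at most two has degree at most two. -/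
theorem HasSmallCodegree.sum_essential_le_two {M : Multicomplex c} (hM : M.HasSmallCodegree)
    {a : Fin m → ℕ} (ha : a ∈ M.monomials) (hsum : ∑ i, (c i - a i) ≤ 2) :
    ∑ i with M.IsEssential i, a i ≤ 2 := by
  by_contra! hlt
  by_cases hbig : ∃ i, M.IsEssential i ∧ 2 ≤ a i
  · obtain ⟨i, hi, hai⟩ := hbig
    obtain ⟨h2, h0⟩ := hM.eq_two ha hi hai
    rw [Finset.sum_eq_single_of_mem i (by simpa using hi)] at hlt
    · omega
    · intro j hj hji
      exact h0 j (by simpa using hj) hji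
  · push Not at hbig
    have hcard : 2 < (Finset.univ.filter fun i => M.IsEssential i ∧ 1 ≤ a i).card := by
      refine hlt.trans_le ?_
      rw [← Finset.filter_filter, Finset.card_filter]
      refine Finset.sum_le_sum fun i hi => ?_
      have := hbig i (by simpa using hi)
      split_ifs <;> omega
    obtain ⟨i, j, l, hi, hj, hl, hij, hil, hjl⟩ := Finset.two_lt_card_iff.1 hcard
    simp only [Finset.mem_filter, Finset.mem_univ, true_and] at hi hj hl
    obtain ⟨p, hp, hpc, hpn, hpa⟩ := hi.1.exists_partner ha hi.2
    obtain ⟨q, hq, hqc, hqn, hqa⟩ := hj.1.exists_partner ha hj.2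
    obtain ⟨r, hr, hrc, hrn, hra⟩ := hl.1.exists_partner ha hl.2
    -- All partners have an exponent below the bound, and there are at most two such variables.
    have key : ∀ {i k : Fin m}, Pi.single i 1 + Pi.single k 1 ≤ c →
        (k = i ∧ a i = 1 ∨ k ≠ i ∧ a k = 0) → 1 ≤ c k - a k := by
      intro i k hc hcase
      have := hc k
      rcases hcase with ⟨rfl, h⟩ | ⟨h, h'⟩
      · simp at this; omega
      · simp at this; omega
    have hp1 := key hpc hpa
    have hq1 := key hqc hqa
    have hr1 := key hrc hra
    by_cases hpq : p = q
    · subst hpq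
      exact hM.false_of_common_partner ha hij hil hjl hi.2 hj.2 hp hpn hqn hpa hqa hrc hrn hra
    by_cases hpr : p = r
    · subst hpr
      exact hM.false_of_common_partner ha hil hij hjl.symm hi.2 hl.2 hp hpn hrn hpa hra hqc hqn hqa
    by_cases hqr : q = r
    · subst hqr
      exact hM.false_of_common_partner ha hjl hij.symm hil.symm hj.2 hl.2 hq hqn hrn hqa hra
        hpc hpn hpa
    have := add_add_le_of_sum_le hsum hpq hpr hqr
    omega

open Classical in
/-- The essential part of `x^c` has degree at most four. -/
theorem HasSmallCodegree.sum_bound_le_four {M : Multicomplex c} (hM : M.HasSmallCodegree) :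
    ∑ i with M.IsEssential i, c i ≤ 4 := by
  obtain ⟨a, ha, -, hsum⟩ := hM 0 M.zero_mem
  have h1 := hM.sum_essential_le_two ha hsum
  have h2 : ∑ i with M.IsEssential i, (c i - a i) ≤ 2 :=
    (Finset.sum_le_sum_of_subset (Finset.subset_univ _)).trans hsum
  have h3 : ∑ i with M.IsEssential i, c i
      = ∑ i with M.IsEssential i, a i + ∑ i with M.IsEssential i, (c i - a i) := by
    rw [← Finset.sum_add_distrib]
    refine Finset.sum_congr rfl fun i _ => ?_
    have : a i ≤ c i := M.le_bound a ha i
    omega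
  omega

/-- Every `c`-monomial outside `M` is divisible by one of degree at most two outside `M`. -/
def HasSmallGenerators (M : Multicomplex c) : Prop :=
  ∀ v ≤ c, v ∉ M.monomials → ∃ b ≤ v, b ∉ M.monomials ∧ ∑ i, b i ≤ 2

open Classical in
/-- Deleting the inessential variables does not bring a monomial into `M`. -/
theorem HasSmallGenerators.essential_part_notMem {M : Multicomplex c} (hM : M.HasSmallGenerators)
    {v : Fin m → ℕ} (hv : v ≤ c) (hvM : v ∉ M.monomials) :
    (fun i => if M.IsEssential i then v i else 0) ∉ M.monomials := by
  intro hmem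
  -- A generator of least degree below `x^v` involves essential variables only.
  obtain ⟨b, hbv, hb, hsum⟩ := hM v hv hvM
  obtain ⟨i, hi⟩ : ∃ i, b i ≠ 0 := by
    by_contra! h
    exact hb ((funext h : b = 0) ▸ M.zero_mem)
  have hout : ∀ i, 1 ≤ v i → (Pi.single i 1 : Fin m → ℕ) ∈ M.monomials := by
    intro i hi
    by_contra hn
    refine hn (M.down_closed hmem (single_le ?_))
    simpa [IsEssential, hn] using hi
  have hvi : 1 ≤ v i := (Nat.one_le_iff_ne_zero.2 hi).trans (hbv i)
  -- Write `b = e_i + b'`, where `b'` has degree at most one.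
  have hbsub : b = Pi.single i 1 + (b - Pi.single i 1) :=
    (add_tsub_cancel_of_le (single_le (by omega))).symm
  have hsum' : ∑ j, (b - Pi.single i 1 : Fin m → ℕ) j ≤ 1 := by
    have : ∑ j, b j = 1 + ∑ j, (b - Pi.single i 1 : Fin m → ℕ) j := by
      conv_lhs => rw [hbsub]
      simp [Finset.sum_add_distrib]
    omega
  by_cases h0 : ∀ j, (b - Pi.single i 1 : Fin m → ℕ) j = 0
  · rw [show b - Pi.single i 1 = 0 from funext h0, add_zero] at hbsub
    exact hb (hbsub ▸ hout i hvi)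
  push Not at h0
  obtain ⟨k, hk⟩ := h0
  have hbk : b - Pi.single i 1 = Pi.single k 1 := by
    funext j
    rcases eq_or_ne j k with rfl | hjk
    · have := Finset.single_le_sum (f := b - Pi.single i 1) (fun _ _ => Nat.zero_le _)
        (Finset.mem_univ j)
      simp only [Pi.single_eq_same]
      omega
    · have := add_le_of_sum_le hsum' hjk
      simp only [Pi.single_eq_of_ne hjk]
      omega
  rw [hbk] at hbsub
  have hvk : 1 ≤ v k := by
    have h1 : b k ≤ v k := hbv k
    have h2 : 1 ≤ b k := by rw [hbsub]; simp
    omega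
  have hbc : Pi.single i 1 + Pi.single k 1 ≤ c := hbsub ▸ hbv.trans hv
  have hei : M.IsEssential i := Or.inr ⟨k, hout k hvk, hbc, hbsub ▸ hb⟩
  have hek : M.IsEssential k := by
    refine Or.inr ⟨i, hout i hvi, ?_, ?_⟩
    · rwa [add_comm]
    · rwa [add_comm, ← hbsub]
  refine hb (M.down_closed hmem fun j => ?_)
  by_cases hj : M.IsEssential j
  · simpa [hj] using hbv j
  · have hji : j ≠ i := by rintro rfl; exact hj hei
    have hjk : j ≠ k := by rintro rfl; exact hj hek
    simp [hbsub, hji, hjk]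

end Multicomplex

/-! ### Faces of the Murai sphere and flagness -/

namespace SimplicialComplexOn

variable {V : Type*}

/-- In a flag complex every non-face contains a non-face with at most two vertices. -/
theorem IsFlag.exists_small_nonface {K : SimplicialComplexOn V} (hK : K.IsFlag) {s : Finset V}
    (hs : s ∉ K.faces) : ∃ t ⊆ s, t ∉ K.faces ∧ t.card ≤ 2 := by
  obtain ⟨t, hts, ht⟩ := exists_minimal_le_of_wellFoundedLT (fun t => t ∉ K.faces) s hs
  exact ⟨t, hts, ht.prop, hK t ht⟩

/-- In a flag complex, a non-face whose deletions of one vertex are all faces is small. -/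
theorem IsFlag.card_le_two {V : Type*} [DecidableEq V] {K : SimplicialComplexOn V} (hK : K.IsFlag)
    {s : Finset V} (hs : s ∉ K.faces) (h : ∀ x ∈ s, s.erase x ∈ K.faces) : s.card ≤ 2 := by
  obtain ⟨t, hts, ht, hcard⟩ := hK.exists_small_nonface hs
  suffices s ⊆ t from (Finset.card_le_card this).trans hcard
  intro x hx
  by_contra hxt
  exact ht (K.down_closed (h x hx) (Finset.subset_erase.2 ⟨hts, hxt⟩))

end SimplicialComplexOn

namespace Multicomplex

variable {m : ℕ} {c : Fin m → ℕ}

/-- The set `s` of vertices contains none of the points `x_1^{(a_1)}, …, x_m^{(a_m)}`. -/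
def Avoids (s : Finset (Vertex c)) (a : Fin m → ℕ) : Prop :=
  ∀ x ∈ s, (x.2 : ℕ) ≠ a x.1

theorem Avoids.mono {s t : Finset (Vertex c)} {a : Fin m → ℕ} (h : Avoids t a) (hst : s ⊆ t) :
    Avoids s a :=
  fun x hx => h x (hst hx)

theorem avoids_F (a : Fin m → ℕ) : Avoids (F c a) a := by
  simp [Avoids, F]

/-- Changing the exponents one at a time, one leaves a set `U` at some step on the way from
`u ∈ U` to `w ∉ U`. -/
theorem exists_update_notMem {U : Set (Fin m → ℕ)} {u w : Fin m → ℕ} (hu : u ∈ U) (hw : w ∉ U) :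
    ∃ a ∈ U, ∃ i, (∀ k, a k = u k ∨ a k = w k) ∧ a i = u i ∧ Function.update a i (w i) ∉ U := by
  by_contra! hcon
  have key : ∀ S : Finset (Fin m), (fun k => if k ∈ S then w k else u k) ∈ U := by
    intro S
    induction S using Finset.induction_on with
    | empty => simpa using hu
    | insert i S hi ih =>
      have := hcon _ ih i (fun k => by by_cases hk : k ∈ S <;> simp [hk]) (by simp [hi])
      convert this using 1
      funext k
      rcases eq_or_ne k i with rfl | hk
      · simp
      · simp [hk]
  exact hw (by simpa using key Finset.univ)

/-- A set of vertices is a face of the Murai sphere if and only if it avoids both the points of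
some element of `M` and the points of some `c`-monomial outside `M`. -/
theorem mem_faces_bier_iff {M : Multicomplex c} {hM : M.IsProper} {s : Finset (Vertex c)} :
    s ∈ (M.bier hM).faces ↔
      (∃ u ∈ M.monomials, Avoids s u) ∧ ∃ w ≤ c, w ∉ M.monomials ∧ Avoids s w := by
  constructor
  · rintro ⟨t, ⟨a, ha, i, j, hij, hnot, rfl⟩, hst⟩
    refine ⟨⟨a, ha, (avoids_F a).mono (hst.trans Finset.sdiff_subset)⟩,
      Function.update a i j, ?_, hnot, ?_⟩
    · rw [update_le_iff]
      exact ⟨Nat.lt_succ_iff.1 j.2, fun k _ => M.le_bound a ha k⟩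
    · rintro ⟨k, r⟩ hx heq
      have hx' := hst hx
      simp only [Finset.mem_sdiff, Finset.mem_singleton, F, Finset.mem_filter, Finset.mem_univ,
        true_and] at hx'
      rcases eq_or_ne k i with rfl | hk
      · refine hx'.2 ?_
        simp only [Function.update_self] at heq
        rw [Fin.ext heq]
      · simp only [Function.update_of_ne hk] at heq
        exact hx'.1 heq
  · rintro ⟨⟨u, hu, hsu⟩, w, hwc, hw, hsw⟩
    -- Pass to the comparable pair `u ⊓ w ≤ u ⊔ w` and move upwards from the first to the second.
    have hinf : u ⊓ w ∈ M.monomials := M.down_closed hu inf_le_left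
    have hsup : u ⊔ w ∉ M.monomials := fun h => hw (M.down_closed h le_sup_right)
    obtain ⟨a, ha, i, hauw, hai, hnot⟩ := exists_update_notMem hinf hsup
    have hmem : ∀ k, a k = u k ∨ a k = w k := by
      intro k
      have := hauw k
      simp only [Pi.inf_apply, Pi.sup_apply] at this
      omega
    have hle : (u ⊔ w) i ≤ c i := sup_le (M.le_bound u hu i) (hwc i)
    have hlt : a i < (u ⊔ w) i := by
      have h1 : a i ≤ (u ⊔ w) i := by rw [hai]; exact inf_le_sup
      refine lt_of_le_of_ne h1 fun h => hnot ?_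
      rwa [← h, Function.update_eq_self]
    refine ⟨_, ⟨a, ha, i, ⟨(u ⊔ w) i, by omega⟩, hlt, hnot, rfl⟩, ?_⟩
    rintro ⟨k, r⟩ hx
    have h1 : (r : ℕ) ≠ u k := hsu _ hx
    have h2 : (r : ℕ) ≠ w k := hsw _ hx
    simp only [Finset.mem_sdiff, Finset.mem_singleton, F, Finset.mem_filter, Finset.mem_univ,
      true_and]
    refine ⟨?_, ?_⟩
    · rcases hmem k with h | h <;> simpa [h]
    · rintro h
      obtain ⟨rfl, h⟩ := Sigma.mk.inj_iff.1 h
      have h' : (r : ℕ) = (u ⊔ w) k := by rw [eq_of_heq h]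
      simp only [Pi.sup_apply] at h'
      omega

theorem not_bound_mem {M : Multicomplex c} (hM : M.IsProper) : c ∉ M.monomials := fun h =>
  hM (Set.Subset.antisymm M.le_bound fun _ hb => M.down_closed h hb)

theorem card_filter_lt {a : Fin m → ℕ} (ha : a ≤ c) :
    (Finset.univ.filter fun x : Vertex c => (x.2 : ℕ) < a x.1).card = ∑ i, a i := by
  have : (Finset.univ.filter fun x : Vertex c => (x.2 : ℕ) < a x.1)
      = Finset.univ.sigma fun i => Finset.univ.filter fun j : Fin (c i + 1) => (j : ℕ) < a i := by
    ext; simp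
  rw [this, Finset.card_sigma]
  refine Finset.sum_congr rfl fun i _ => ?_
  have := ha i
  rw [Fin.card_filter_val_lt]
  exact min_eq_right (this.trans (Nat.le_succ _))

theorem card_filter_gt {a : Fin m → ℕ} :
    (Finset.univ.filter fun x : Vertex c => a x.1 < (x.2 : ℕ)).card = ∑ i, (c i - a i) := by
  have : (Finset.univ.filter fun x : Vertex c => a x.1 < (x.2 : ℕ))
      = Finset.univ.sigma fun i => Finset.univ.filter fun j : Fin (c i + 1) => a i < (j : ℕ) := by
    ext; simp
  rw [this, Finset.card_sigma]
  refine Finset.sum_congr rfl fun i _ => ?_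
  have h1 := Finset.card_filter_add_card_filter_not (s := (Finset.univ : Finset (Fin (c i + 1))))
    (fun j => (j : ℕ) < a i + 1)
  rw [Fin.card_filter_val_lt] at h1
  simp only [not_lt, Nat.succ_le_iff, Finset.card_univ, Fintype.card_fin] at h1
  omega

/-- A minimal `c`-monomial `x^b` outside `M` gives the minimal non-face of the `x_i^{(j)}` with
`j < b_i`. -/
theorem hasSmallGenerators_of_isFlag {M : Multicomplex c} {hM : M.IsProper}
    (hflag : (M.bier hM).IsFlag) : M.HasSmallGenerators := by
  intro v hv hvM
  obtain ⟨b, hbv, hb⟩ := exists_minimal_le_of_wellFoundedLT (fun b => b ∉ M.monomials) v hvM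
  have hbc := hbv.trans hv
  refine ⟨b, hbv, hb.prop, ?_⟩
  rw [← card_filter_lt hbc]
  refine hflag.card_le_two ?_ ?_
  · rw [mem_faces_bier_iff]
    rintro ⟨⟨u, hu, hsu⟩, -⟩
    refine hb.prop (M.down_closed hu fun i => ?_)
    by_contra! hlt
    exact hsu ⟨i, u i, Nat.lt_succ_iff.2 (M.le_bound u hu i)⟩ (by simpa using hlt) rfl
  · rintro ⟨i, j⟩ hij
    simp only [Finset.mem_filter, Finset.mem_univ, true_and] at hij
    rw [mem_faces_bier_iff]
    refine ⟨⟨Function.update b i j, ?_, ?_⟩, c, le_rfl, not_bound_mem hM, ?_⟩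
    · by_contra hn
      have := hb.le_of_le hn (update_le_self_iff.2 hij.le) i
      simp at this
      omega
    · rintro ⟨k, r⟩ hx
      simp only [Finset.mem_erase, Finset.mem_filter, Finset.mem_univ, true_and] at hx
      rcases eq_or_ne k i with rfl | hk
      · simp only [Function.update_self]
        exact fun h => hx.1 (by rw [Fin.ext h])
      · simp only [Function.update_of_ne hk]
        exact hx.2.ne
    · rintro ⟨k, r⟩ hx
      simp only [Finset.mem_erase, Finset.mem_filter, Finset.mem_univ, true_and] at hx
      exact (hx.2.trans_le (hbc k)).ne

/-- A maximal element `x^a` of `M` gives the minimal non-face of the `x_i^{(j)}` with `a_i < j`. -/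
theorem hasSmallCodegree_of_isFlag {M : Multicomplex c} {hM : M.IsProper}
    (hflag : (M.bier hM).IsFlag) : M.HasSmallCodegree := by
  intro v hv
  have hfin : M.monomials.Finite := (Set.finite_Iic c).subset M.le_bound
  obtain ⟨a, hva, ha⟩ := hfin.exists_le_maximal hv
  refine ⟨a, ha.prop, hva, ?_⟩
  rw [← card_filter_gt]
  refine hflag.card_le_two ?_ ?_
  · rw [mem_faces_bier_iff]
    rintro ⟨-, w, hwc, hw, hsw⟩
    refine hw (M.down_closed ha.prop fun i => ?_)
    by_contra! hlt
    exact hsw ⟨i, w i, Nat.lt_succ_iff.2 (hwc i)⟩ (by simpa using hlt) rfl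
  · rintro ⟨i, j⟩ hij
    simp only [Finset.mem_filter, Finset.mem_univ, true_and] at hij
    rw [mem_faces_bier_iff]
    refine ⟨⟨0, M.zero_mem, ?_⟩, Function.update a i j, ?_, ?_, ?_⟩
    · rintro ⟨k, r⟩ hx
      simp only [Finset.mem_erase, Finset.mem_filter, Finset.mem_univ, true_and] at hx
      exact (Nat.zero_lt_of_lt hx.2).ne'
    · rw [update_le_iff]
      exact ⟨Nat.lt_succ_iff.1 j.2, fun k _ => M.le_bound a ha.prop k⟩
    · intro hn
      have := ha.le_of_ge hn (le_update_self_iff.2 hij.le) i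
      simp at this
      omega
    · rintro ⟨k, r⟩ hx
      simp only [Finset.mem_erase, Finset.mem_filter, Finset.mem_univ, true_and] at hx
      rcases eq_or_ne k i with rfl | hk
      · simp only [Function.update_self]
        exact fun h => hx.1 (by rw [Fin.ext h])
      · simp only [Function.update_of_ne hk]
        exact hx.2.ne'

/-- The `c_i + 1` points `x_i^{(j)}` form a non-face, which is not minimal if `c_i ≥ 2`; hence an
inessential variable has exponent at most one. -/
theorem bound_eq_one_of_not_isEssential {M : Multicomplex c} {hM : M.IsProper}
    (hc : ∀ i, 0 < c i) (hflag : (M.bier hM).IsFlag) {i : Fin m} (hi : ¬ M.IsEssential i) :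
    c i = 1 := by
  classical
  have hess := @(hasSmallGenerators_of_isFlag hflag).essential_part_notMem
  have hne : ∀ {j}, M.IsEssential j → j ≠ i := fun hj h => hi (h ▸ hj)
  have h1 : ∀ j ≤ c i, (Pi.single i j : Fin m → ℕ) ∈ M.monomials := by
    intro j hj
    by_contra hn
    have hle : (Pi.single i j : Fin m → ℕ) ≤ c := by
      intro k
      rcases eq_or_ne k i with rfl | hk <;> simp [*]
    refine hess hle hn ?_
    convert M.zero_mem using 1
    funext k
    by_cases hk : M.IsEssential k <;> simp [hk, hne]
  have h2 : ∀ j, Function.update c i j ∉ M.monomials := by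
    intro j hn
    refine hess (v := c) le_rfl (not_bound_mem hM) (M.down_closed hn fun k => ?_)
    by_cases hk : M.IsEssential k <;> simp [hk, hne]
  have h3 := hflag.card_le_two (s := Finset.univ.filter fun x : Vertex c => x.1 = i) ?_ ?_
  · have : (Finset.univ.filter fun x : Vertex c => x.1 = i).card = c i + 1 := by
      have : (Finset.univ.filter fun x : Vertex c => x.1 = i)
          = ({i} : Finset (Fin m)).sigma fun _ => Finset.univ := by
        ext; simp
      rw [this, Finset.card_sigma]
      simp
    have := hc i
    omega
  · rw [mem_faces_bier_iff]
    rintro ⟨⟨u, hu, hsu⟩, -⟩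
    exact hsu ⟨i, u i, Nat.lt_succ_iff.2 (M.le_bound u hu i)⟩ (by simp) rfl
  · rintro ⟨k, j⟩ hij
    obtain rfl : k = i := by simpa using hij
    have hj := Nat.lt_succ_iff.1 j.2
    rw [mem_faces_bier_iff]
    refine ⟨⟨Pi.single k j, h1 j hj, ?_⟩, Function.update c k j,
      update_le_self_iff.2 hj, h2 j, ?_⟩
    all_goals
      rintro ⟨l, r⟩ hx
      simp only [Finset.mem_erase, Finset.mem_filter, Finset.mem_univ, true_and] at hx
      obtain ⟨hx, rfl⟩ := hx
      simp only [Function.update_self, Pi.single_eq_same]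
      exact fun h => hx (by rw [Fin.ext h])

end Multicomplex

/-! ### Dimension and number of vertices -/

namespace Multicomplex

variable {m : ℕ} {c : Fin m → ℕ}

theorem card_vertex : Fintype.card (Vertex c) = ∑ i, c i + m := by
  simp [Finset.sum_add_distrib]

/-- The points `x_1^{(a_1)}, …, x_m^{(a_m)}`. -/
def points (c a : Fin m → ℕ) : Finset (Vertex c) :=
  Finset.univ.filter fun v => (v.2 : ℕ) = a v.1

theorem card_points {a : Fin m → ℕ} (ha : a ≤ c) : (points c a).card = m := by
  have : points c a = Finset.univ.sigma fun i =>
      ({⟨a i, Nat.lt_succ_iff.2 (ha i)⟩} : Finset (Fin (c i + 1))) := by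
    ext ⟨i, j⟩
    simp [points, Fin.ext_iff]
  rw [this, Finset.card_sigma]
  simp

theorem F_eq_compl_points (a : Fin m → ℕ) : F c a = (points c a)ᶜ := by
  ext; simp [F, points]

theorem card_F {a : Fin m → ℕ} (ha : a ≤ c) : (F c a).card = ∑ i, c i := by
  rw [F_eq_compl_points, Finset.card_compl, card_points ha, card_vertex]
  omega

theorem card_of_mem_bierFacets {M : Multicomplex c} {s : Finset (Vertex c)}
    (hs : s ∈ M.bierFacets) : s.card + 1 = ∑ i, c i := by
  obtain ⟨a, ha, i, j, hij, -, rfl⟩ := hs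
  rw [← card_F (M.le_bound a ha), Finset.sdiff_singleton_eq_erase]
  refine Finset.card_erase_add_one ?_
  simpa [F] using hij.ne'

theorem card_le_of_mem_faces {M : Multicomplex c} {hM : M.IsProper} {s : Finset (Vertex c)}
    (hs : s ∈ (M.bier hM).faces) : s.card + 1 ≤ ∑ i, c i := by
  obtain ⟨t, ht, hst⟩ := hs
  have := Finset.card_le_card hst
  have := card_of_mem_bierFacets ht
  omega

/-- The Murai sphere has dimension `|c| - 2`. -/
theorem rank_bier_add_one (M : Multicomplex c) (hM : M.IsProper) :
    (M.bier hM).rank + 1 = ∑ i, c i := by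
  obtain ⟨t, ht⟩ := M.bierFacets_nonempty hM
  have hcard := card_of_mem_bierFacets ht
  have : IsGreatest (Finset.card '' (M.bier hM).faces) t.card := by
    refine ⟨⟨t, ⟨t, ht, subset_rfl⟩, rfl⟩, ?_⟩
    rintro _ ⟨s, hs, rfl⟩
    have := card_le_of_mem_faces hs
    omega
  rw [SimplicialComplexOn.rank, this.csSup_eq, hcard]

/-- Each vertex `x` of a facet `s` of the Murai sphere can be exchanged: some vertex `y` outside `s`
spans a face with the ridge `s \ {x}`. -/
theorem exists_exchange {M : Multicomplex c} {hM : M.IsProper} {s : Finset (Vertex c)}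
    (hs : s ∈ M.bierFacets) {x : Vertex c} (hx : x ∈ s) :
    ∃ y ∉ s, insert y (s.erase x) ∈ (M.bier hM).faces := by
  obtain ⟨a, ha, i, j, hij, hb, rfl⟩ := hs
  obtain ⟨k, r⟩ := x
  have hac := M.le_bound a ha
  have hjc := Nat.lt_succ_iff.1 j.2
  have hrc := Nat.lt_succ_iff.1 r.2
  have hxa : (r : ℕ) ≠ a k := by
    simp only [Finset.mem_sdiff, F, Finset.mem_filter] at hx
    exact hx.1.2
  have hbc : Function.update a i (j : ℕ) ≤ c := update_le_iff.2 ⟨hjc, fun p _ => hac p⟩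
  -- The complement of `s` consists of the points of `x^a` and `x_i^{(j)}`. A monomial built from
  -- these points and `x = x_k^{(r)}` is avoided by `s \ {x}`, so it only has to omit `y`.
  have hav : ∀ (y : Vertex c) (u : Fin m → ℕ), (y.2 : ℕ) ≠ u y.1 →
      (∀ p, u p = a p ∨ u p = Function.update a i (j : ℕ) p ∨ p = k ∧ u p = r) →
      Avoids (insert y ((F c a \ {⟨i, j⟩}).erase ⟨k, r⟩)) u := by
    rintro y u hyu hu ⟨p, q⟩ hmem
    rcases Finset.mem_insert.1 hmem with rfl | hmem
    · exact hyu
    simp only [Finset.mem_erase, Finset.mem_sdiff, F, Finset.mem_filter, Finset.mem_univ, true_and,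
      Finset.mem_singleton] at hmem
    obtain ⟨h1, h2, h3⟩ := hmem
    intro heq
    simp only at heq h2
    rcases hu p with h | h | ⟨rfl, h⟩
    · exact h2 (heq.trans h)
    · rcases eq_or_ne p i with rfl | hp
      · rw [Function.update_self] at h
        exact h3 (by rw [Fin.ext (heq.trans h)])
      · rw [Function.update_of_ne hp] at h
        exact h2 (heq.trans h)
    · exact h1 (by rw [Fin.ext (heq.trans h)])
  have hmk : ∀ (y : Vertex c), y ∉ F c a \ {⟨i, j⟩} → ∀ u w : Fin m → ℕ,
      u ∈ M.monomials → w ≤ c → w ∉ M.monomials → (y.2 : ℕ) ≠ u y.1 → (y.2 : ℕ) ≠ w y.1 →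
      (∀ p, u p = a p ∨ u p = Function.update a i (j : ℕ) p ∨ p = k ∧ u p = r) →
      (∀ p, w p = a p ∨ w p = Function.update a i (j : ℕ) p ∨ p = k ∧ w p = r) →
      ∃ y ∉ F c a \ {⟨i, j⟩},
        insert y ((F c a \ {⟨i, j⟩}).erase ⟨k, r⟩) ∈ (M.bier hM).faces :=
    fun y hy u w hu hwc hw hyu hyw hu' hw' =>
      ⟨y, hy, mem_faces_bier_iff.2 ⟨⟨u, hu, hav y u hyu hu'⟩, w, hwc, hw, hav y w hyw hw'⟩⟩
  have hyj : (⟨i, j⟩ : Vertex c) ∉ F c a \ {⟨i, j⟩} := by simp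
  have hya : ∀ p, (⟨p, a p, Nat.lt_succ_iff.2 (hac p)⟩ : Vertex c) ∉ F c a \ {⟨i, j⟩} := by
    simp [F]
  have ha'c : Function.update a k (r : ℕ) ≤ c := update_le_iff.2 ⟨hrc, fun p _ => hac p⟩
  have hupd : ∀ (b : Fin m → ℕ) (q : Fin m) (v : ℕ) (p : Fin m),
      p = q ∧ Function.update b q v p = v ∨ p ≠ q ∧ Function.update b q v p = b p := by
    intro b q v p
    rcases eq_or_ne p q with rfl | h <;> simp [*]
  -- With `b` the replacement of `a_i` by `j` in `a`, the pair `a ∈ M`, `b ∉ M` is modified by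
  -- setting the exponent of `x_k` to `r` in one or both of `a` and `b`; `y` is a discarded point.
  by_cases ha' : Function.update a k (r : ℕ) ∈ M.monomials
  · rcases eq_or_ne k i with rfl | hki
    · refine hmk _ (hya k) _ _ ha' hbc hb (by simpa using hxa.symm) (by simpa using hij.ne)
        (fun p => ?_) (fun p => Or.inr (Or.inl rfl))
      have := hupd a k r p
      tauto
    · have hb'c : Function.update (Function.update a i (j : ℕ)) k (r : ℕ) ≤ c :=
        update_le_iff.2 ⟨hrc, fun p _ => hbc p⟩
      by_cases hb' : Function.update (Function.update a i (j : ℕ)) k (r : ℕ) ∈ M.monomials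
      · refine hmk _ (hya i) _ _ hb' hbc hb (by simpa [hki.symm] using hij.ne)
          (by simpa using hij.ne) (fun p => ?_) (fun p => Or.inr (Or.inl rfl))
        have := hupd (Function.update a i (j : ℕ)) k r p
        tauto
      · refine hmk _ (hya k) _ _ ha' hb'c hb' (by simpa using hxa.symm) (by simpa using hxa.symm)
          (fun p => ?_) (fun p => ?_)
        · have := hupd a k r p
          tauto
        · have := hupd (Function.update a i (j : ℕ)) k r p
          tauto
  · have hne : k = i → (j : ℕ) ≠ r := by
      rintro rfl h
      simp only [Finset.mem_sdiff, Finset.mem_singleton] at hx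
      exact hx.2 (by rw [Fin.ext h])
    refine hmk _ hyj _ _ ha ha'c ha' hij.ne' ?_ (fun p => Or.inl rfl) (fun p => ?_)
    · rcases hupd a k r i with h | h
      · simpa [h.2] using hne h.1.symm
      · simpa [h.2] using hij.ne'
    · have := hupd a k r p
      tauto

/-- A flag Murai sphere with facets of size `n` has at least `2n` vertices: by flagness the
vertices exchanged for the different vertices of a facet are distinct. -/
theorem two_mul_rank_le_fVector_one {M : Multicomplex c} {hM : M.IsProper}
    (hflag : (M.bier hM).IsFlag) : 2 * (M.bier hM).rank ≤ (M.bier hM).fVector 1 := by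
  classical
  obtain ⟨s, hs⟩ := M.bierFacets_nonempty hM
  have hsf : s ∈ (M.bier hM).faces := ⟨s, hs, subset_rfl⟩
  have hcard : s.card = (M.bier hM).rank := by
    have := card_of_mem_bierFacets hs
    have := rank_bier_add_one M hM
    omega
  choose! y hys hy using fun x (hx : x ∈ s) => exists_exchange (hM := hM) hs hx
  have hinj : Set.InjOn y s := by
    intro x hx x' hx' heq
    by_contra hne
    have hnf : insert (y x) s ∉ (M.bier hM).faces := by
      intro h
      have h1 := card_le_of_mem_faces h
      rw [Finset.card_insert_of_notMem (hys x hx)] at h1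
      have := card_of_mem_bierFacets hs
      omega
    obtain ⟨t, hts, ht, htcard⟩ := hflag.exists_small_nonface hnf
    have hmem : ∀ z ∈ s, y z = y x → z ∈ t := by
      intro z hz hzx
      by_contra hzt
      refine ht ((M.bier hM).down_closed (hy z hz) fun v hv => ?_)
      rw [hzx]
      have := hts hv
      simp only [Finset.mem_insert, Finset.mem_erase] at this ⊢
      exact this.imp_right fun h => ⟨fun hvz => hzt (hvz ▸ hv), h⟩
    have hpair : {x, x'} = t := by
      refine Finset.eq_of_subset_of_card_le ?_ ?_
      · intro z hz
        rcases Finset.mem_insert.1 hz with rfl | hz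
        · exact hmem z hx rfl
        · rw [Finset.mem_singleton.1 hz]
          exact hmem x' hx' heq.symm
      · rwa [Finset.card_pair hne]
    refine ht ((M.bier hM).down_closed hsf ?_)
    rw [← hpair]
    intro z hz
    rcases Finset.mem_insert.1 hz with rfl | hz
    · exact hx
    · rwa [Finset.mem_singleton.1 hz]
  have hdisj : Disjoint s (s.image y) := by
    rw [Finset.disjoint_left]
    rintro z hz hzy
    obtain ⟨x, hx, rfl⟩ := Finset.mem_image.1 hzy
    exact hys x hx hz
  have hcard2 : ((s ∪ s.image y).image fun v => ({v} : Finset (Vertex c))).card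
      = 2 * (M.bier hM).rank := by
    rw [Finset.card_image_of_injective _ Finset.singleton_injective,
      Finset.card_union_of_disjoint hdisj, Finset.card_image_of_injOn hinj, hcard, two_mul]
  rw [← hcard2, ← Set.ncard_coe_finset]
  refine Set.ncard_le_ncard ?_ (Set.toFinite _)
  intro p hp
  simp only [Finset.coe_image, Set.mem_image, Finset.mem_coe, Finset.mem_union,
    Finset.mem_image] at hp
  obtain ⟨z, hz, rfl⟩ := hp
  refine ⟨?_, Finset.card_singleton z⟩
  rcases hz with hz | ⟨x, hx, rfl⟩
  · exact (M.bier hM).down_closed hsf (by simpa using hz)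
  · exact (M.bier hM).down_closed (hy x hx) (by simp)

end Multicomplex

/-! ### The generating function of the faces -/

open Polynomial in
theorem SimplicialComplexOn.shiftedFPolynomial_eq_sum {V : Type*} [Fintype V]
    (K : SimplicialComplexOn V) [DecidablePred (· ∈ K.faces)] :
    K.shiftedFPolynomial = ∑ s with s ∈ K.faces, (X - 1 : ℤ[X]) ^ (K.rank - s.card) := by
  have hle : ∀ s ∈ K.faces, s.card ≤ K.rank := fun s hs =>
    le_csSup (Set.toFinite _).bddAbove ⟨s, hs, rfl⟩
  rw [← Finset.sum_fiberwise_of_maps_to (t := Finset.range (K.rank + 1)) (g := Finset.card)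
    (fun s hs => Finset.mem_range.2 (Nat.lt_succ_iff.2 (hle s (by simpa using hs))))]
  refine Finset.sum_congr rfl fun i _ => ?_
  rw [Finset.sum_congr rfl fun s hs => by rw [(Finset.mem_filter.1 hs).2], Finset.sum_const,
    Finset.filter_filter, fVector, ← Set.ncard_coe_finset]
  simp

theorem sum_Icc_pow_card {α R : Type*} [DecidableEq α] [CommSemiring R] {A B : Finset α}
    (h : A ⊆ B) (y : R) :
    ∑ T ∈ Finset.Icc A B, y ^ T.card = y ^ A.card * (y + 1) ^ (B \ A).card := by
  rw [Finset.Icc_eq_image_powerset h, Finset.sum_image]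
  · have := Finset.sum_pow_mul_eq_add_pow y 1 (B \ A)
    simp only [one_pow, mul_one] at this
    rw [← this, Finset.mul_sum]
    refine Finset.sum_congr rfl fun T hT => ?_
    rw [Finset.card_union_of_disjoint, pow_add]
    exact (Finset.disjoint_sdiff.mono_right (Finset.mem_powerset.1 hT))
  · intro T hT T' hT' heq
    have hd : ∀ T ∈ ((B \ A).powerset : Set (Finset α)), (A ∪ T) \ A = T := fun T hT =>
      Finset.union_sdiff_cancel_left
        (Finset.disjoint_sdiff.mono_right (Finset.mem_powerset.1 hT))
    rw [← hd T hT, ← hd T' hT']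
    exact congrArg (· \ A) heq

namespace Multicomplex

variable {m : ℕ} {c : Fin m → ℕ}

open Classical in
/-- The finite set of the `c`-monomials outside `M`. -/
noncomputable def outside (M : Multicomplex c) : Finset (Fin m → ℕ) :=
  (Finset.Iic c).filter (· ∉ M.monomials)

theorem mem_outside {M : Multicomplex c} {v : Fin m → ℕ} :
    v ∈ M.outside ↔ v ≤ c ∧ v ∉ M.monomials := by
  simp [outside]

/-- The sets of vertices whose highest points are `x_1^{(a_1)}, …, x_m^{(a_m)}`. -/
def setsWithTop (c a : Fin m → ℕ) : Finset (Finset (Vertex c)) :=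
  Finset.Icc (points c a) (Finset.univ.filter fun x => (x.2 : ℕ) ≤ a x.1)

/-- The sets of vertices whose lowest points are `x_1^{(a_1)}, …, x_m^{(a_m)}`. -/
def setsWithBottom (c a : Fin m → ℕ) : Finset (Finset (Vertex c)) :=
  Finset.Icc (points c a) (Finset.univ.filter fun x => a x.1 ≤ (x.2 : ℕ))

theorem mem_of_points_subset {a : Fin m → ℕ} (ha : a ≤ c) {T : Finset (Vertex c)}
    (h : points c a ⊆ T) (i : Fin m) : (⟨i, a i, Nat.lt_succ_iff.2 (ha i)⟩ : Vertex c) ∈ T :=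
  h (by simp [points])

theorem mem_setsWithTop {a : Fin m → ℕ} {T : Finset (Vertex c)} :
    T ∈ setsWithTop c a ↔ points c a ⊆ T ∧ ∀ x ∈ T, (x.2 : ℕ) ≤ a x.1 := by
  simp [setsWithTop, Finset.subset_iff]

theorem mem_setsWithBottom {a : Fin m → ℕ} {T : Finset (Vertex c)} :
    T ∈ setsWithBottom c a ↔ points c a ⊆ T ∧ ∀ x ∈ T, a x.1 ≤ (x.2 : ℕ) := by
  simp [setsWithBottom, Finset.subset_iff]

theorem sum_setsWithTop {R : Type*} [CommSemiring R] (y : R) {a : Fin m → ℕ} (ha : a ≤ c) :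
    ∑ T ∈ setsWithTop c a, y ^ T.card = y ^ m * (y + 1) ^ ∑ i, a i := by
  rw [setsWithTop, sum_Icc_pow_card, card_points ha, ← card_filter_lt ha]
  · congr 3
    ext x
    simp [points, lt_iff_le_and_ne]
  · intro x
    simp +contextual [points]

theorem sum_setsWithBottom {R : Type*} [CommSemiring R] (y : R) {a : Fin m → ℕ} (ha : a ≤ c) :
    ∑ T ∈ setsWithBottom c a, y ^ T.card = y ^ m * (y + 1) ^ ∑ i, (c i - a i) := by
  rw [setsWithBottom, sum_Icc_pow_card, card_points ha, ← card_filter_gt]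
  · congr 3
    ext x
    simp [points, lt_iff_le_and_ne, eq_comm]
  · intro x
    simp +contextual [points]

theorem points_subset_iff {a : Fin m → ℕ} {s : Finset (Vertex c)} :
    points c a ⊆ sᶜ ↔ Avoids s a := by
  simp only [Finset.subset_iff, points, Finset.mem_filter, Finset.mem_univ, true_and,
    Finset.mem_compl, Avoids]
  exact forall_congr' fun x => ⟨fun h hx h' => h h' hx, fun h h' hx => h hx h'⟩

/-- A set with a point in every fibre has highest points. -/
theorem exists_mem_setsWithTop {a : Fin m → ℕ} (ha : a ≤ c) {T : Finset (Vertex c)}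
    (h : points c a ⊆ T) : ∃ v ≤ c, a ≤ v ∧ T ∈ setsWithTop c v := by
  have hex : ∀ i, ∃ j : Fin (c i + 1), (⟨i, j⟩ : Vertex c) ∈ T ∧
      ∀ j' : Fin (c i + 1), (⟨i, j'⟩ : Vertex c) ∈ T → j' ≤ j := by
    intro i
    obtain ⟨j, hj, hmax⟩ := Finset.exists_max_image
      (Finset.univ.filter fun j : Fin (c i + 1) => (⟨i, j⟩ : Vertex c) ∈ T) id
      ⟨_, by simpa using mem_of_points_subset ha h i⟩
    exact ⟨j, by simpa using hj, fun j' hj' => hmax j' (by simpa using hj')⟩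
  choose v hv hmax using hex
  refine ⟨fun i => v i, fun i => Nat.lt_succ_iff.1 (v i).2, fun i =>
    hmax i _ (mem_of_points_subset ha h i), mem_setsWithTop.2 ⟨?_, fun x hx => hmax x.1 x.2 hx⟩⟩
  rintro ⟨i, j⟩ hij
  simp only [points, Finset.mem_filter, Finset.mem_univ, true_and] at hij
  rw [Fin.ext hij]
  exact hv i

/-- A set with a point in every fibre has lowest points. -/
theorem exists_mem_setsWithBottom {a : Fin m → ℕ} (ha : a ≤ c) {T : Finset (Vertex c)}
    (h : points c a ⊆ T) : ∃ v ≤ a, T ∈ setsWithBottom c v := by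
  have hex : ∀ i, ∃ j : Fin (c i + 1), (⟨i, j⟩ : Vertex c) ∈ T ∧
      ∀ j' : Fin (c i + 1), (⟨i, j'⟩ : Vertex c) ∈ T → j ≤ j' := by
    intro i
    obtain ⟨j, hj, hmin⟩ := Finset.exists_min_image
      (Finset.univ.filter fun j : Fin (c i + 1) => (⟨i, j⟩ : Vertex c) ∈ T) id
      ⟨_, by simpa using mem_of_points_subset ha h i⟩
    exact ⟨j, by simpa using hj, fun j' hj' => hmin j' (by simpa using hj')⟩
  choose v hv hmin using hex
  refine ⟨fun i => v i, fun i =>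
    hmin i _ (mem_of_points_subset ha h i), mem_setsWithBottom.2 ⟨?_, fun x hx => hmin x.1 x.2 hx⟩⟩
  rintro ⟨i, j⟩ hij
  simp only [points, Finset.mem_filter, Finset.mem_univ, true_and] at hij
  rw [Fin.ext hij]
  exact hv i

/-- A set `s` is a face if and only if the highest points of its complement form a `c`-monomial
outside `M`, and the lowest ones a monomial of `M`. -/
theorem mem_faces_iff_compl {M : Multicomplex c} {hM : M.IsProper} {s : Finset (Vertex c)} :
    s ∈ (M.bier hM).faces ↔
      sᶜ ∈ M.outside.biUnion (setsWithTop c) \ M.outside.biUnion (setsWithBottom c) := by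
  simp only [mem_faces_bier_iff, Finset.mem_sdiff, Finset.mem_biUnion, not_exists, not_and,
    ← points_subset_iff]
  constructor
  · rintro ⟨⟨u, hu, hsu⟩, w, hwc, hw, hsw⟩
    refine ⟨?_, fun v hv hmem => ?_⟩
    · obtain ⟨v, hvc, hwv, hv⟩ := exists_mem_setsWithTop hwc hsw
      exact ⟨v, mem_outside.2 ⟨hvc, fun h => hw (M.down_closed h hwv)⟩, hv⟩
    · refine (mem_outside.1 hv).2 (M.down_closed hu fun i => ?_)
      exact (mem_setsWithBottom.1 hmem).2 _ (mem_of_points_subset (M.le_bound u hu) hsu i)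
  · rintro ⟨⟨v, hv, hmem⟩, hbot⟩
    obtain ⟨hvc, hvM⟩ := mem_outside.1 hv
    have hsv := (mem_setsWithTop.1 hmem).1
    refine ⟨?_, v, hvc, hvM, hsv⟩
    obtain ⟨u, huv, hu⟩ := exists_mem_setsWithBottom hvc hsv
    refine ⟨u, ?_, (mem_setsWithBottom.1 hu).1⟩
    by_contra hn
    exact hbot u (mem_outside.2 ⟨huv.trans hvc, hn⟩) hu

open Polynomial in
/-- `(t - 1) ∑ f_{i-1} (t - 1)^{n-i} = ∑ (t^{|v|} - t^{|c|-|v|})`, the sum being over the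
`c`-monomials `x^v` outside `M`. -/
theorem mul_shiftedFPolynomial_bier (M : Multicomplex c) (hM : M.IsProper) :
    (X - 1) * (M.bier hM).shiftedFPolynomial =
      ∑ v ∈ M.outside, (X : ℤ[X]) ^ ∑ i, v i - ∑ v ∈ M.outside, (X : ℤ[X]) ^ ∑ i, (c i - v i) := by
  classical
  have hX : (X - 1 : ℤ[X]) ≠ 0 := by simpa using X_sub_C_ne_zero (1 : ℤ)
  refine mul_left_cancel₀ (pow_ne_zero m hX) ?_
  have htop : ∑ T ∈ M.outside.biUnion (setsWithTop c), (X - 1 : ℤ[X]) ^ T.card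
      = (X - 1) ^ m * ∑ v ∈ M.outside, (X : ℤ[X]) ^ ∑ i, v i := by
    rw [Finset.sum_biUnion, Finset.mul_sum]
    · refine Finset.sum_congr rfl fun v hv => ?_
      rw [sum_setsWithTop _ (mem_outside.1 hv).1, sub_add_cancel]
    · intro v hv w hw hne
      refine Finset.disjoint_left.2 fun T hT hT' => hne ?_
      rw [mem_setsWithTop] at hT hT'
      exact le_antisymm
        (fun i => hT'.2 _ (mem_of_points_subset (mem_outside.1 hv).1 hT.1 i))
        (fun i => hT.2 _ (mem_of_points_subset (mem_outside.1 hw).1 hT'.1 i))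
  have hbot : ∑ T ∈ M.outside.biUnion (setsWithBottom c), (X - 1 : ℤ[X]) ^ T.card
      = (X - 1) ^ m * ∑ v ∈ M.outside, (X : ℤ[X]) ^ ∑ i, (c i - v i) := by
    rw [Finset.sum_biUnion, Finset.mul_sum]
    · refine Finset.sum_congr rfl fun v hv => ?_
      rw [sum_setsWithBottom _ (mem_outside.1 hv).1, sub_add_cancel]
    · intro v hv w hw hne
      refine Finset.disjoint_left.2 fun T hT hT' => hne ?_
      rw [mem_setsWithBottom] at hT hT'
      exact le_antisymm
        (fun i => hT.2 _ (mem_of_points_subset (mem_outside.1 hw).1 hT'.1 i))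
        (fun i => hT'.2 _ (mem_of_points_subset (mem_outside.1 hv).1 hT.1 i))
  have hsub : M.outside.biUnion (setsWithBottom c) ⊆ M.outside.biUnion (setsWithTop c) := by
    intro T hT
    obtain ⟨u, hu, hT⟩ := Finset.mem_biUnion.1 hT
    obtain ⟨huc, hu⟩ := mem_outside.1 hu
    obtain ⟨v, hvc, huv, hv⟩ := exists_mem_setsWithTop huc (mem_setsWithBottom.1 hT).1
    exact Finset.mem_biUnion.2 ⟨v, mem_outside.2 ⟨hvc, fun h => hu (M.down_closed h huv)⟩, hv⟩
  rw [mul_sub, ← htop, ← hbot, ← Finset.sum_sdiff_eq_sub hsub,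
    SimplicialComplexOn.shiftedFPolynomial_eq_sum, ← mul_assoc, ← pow_succ, Finset.mul_sum]
  refine Finset.sum_bij' (fun s _ => sᶜ) (fun T _ => Tᶜ) ?_ ?_ ?_ ?_ ?_
  · intro s hs
    exact mem_faces_iff_compl.1 (by simpa using hs)
  · intro T hT
    simpa [mem_faces_iff_compl] using hT
  · simp
  · simp
  · intro s hs
    have hs := card_le_of_mem_faces (hM := hM) (s := s) (by simpa using hs)
    have := rank_bier_add_one M hM
    rw [← pow_add, Finset.card_compl, card_vertex]
    congr 1
    omega

end Multicomplex

/-! ### Complexes whose `γ`-vector has two entries -/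

namespace SimplicialComplexOn

open Polynomial

variable {V : Type*}

/-- The `γ`-vector is unique: the `i`-th summand of the `γ`-expansion has lowest term
`γ_i t^i`. -/
theorem IsGammaVector.unique {K : SimplicialComplexOn V} {γ γ' : ℕ → ℤ} (h : K.IsGammaVector γ)
    (h' : K.IsGammaVector γ') : γ = γ' := by
  have hcoeff : ∀ (γ : ℕ → ℤ) (i : ℕ), i ≤ K.rank / 2 →
      (∑ j ∈ Finset.range (K.rank / 2 + 1),
        C (γ j) * X ^ j * (1 + X) ^ (K.rank - 2 * j)).coeff i =
      ∑ j ∈ Finset.range i, γ j * ((K.rank - 2 * j).choose (i - j) : ℤ) + γ i := by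
    intro γ i hi
    rw [finsetSum_coeff, ← Finset.sum_subset (Finset.range_mono (Nat.succ_le_succ hi)),
      Finset.sum_range_succ]
    · congr 1
      · refine Finset.sum_congr rfl fun j hj => ?_
        have := Finset.mem_range.1 hj
        rw [mul_assoc, coeff_C_mul, coeff_X_pow_mul', if_pos this.le, coeff_one_add_X_pow]
      · rw [mul_assoc, coeff_C_mul, coeff_X_pow_mul', if_pos le_rfl, coeff_one_add_X_pow]
        simp
    · intro j _ hj
      have : ¬ j ≤ i := by simpa using hj
      rw [mul_assoc, coeff_C_mul, coeff_X_pow_mul', if_neg this, mul_zero]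
  funext i
  induction i using Nat.strong_induction_on with
  | _ i ih =>
    rcases le_or_gt i (K.rank / 2) with hi | hi
    · have h1 := hcoeff γ i hi
      have h2 := hcoeff γ' i hi
      rw [← h.2] at h1
      rw [← h'.2, h1] at h2
      rw [Finset.sum_congr rfl fun j hj => by rw [ih j (Finset.mem_range.1 hj)]] at h2
      exact add_left_cancel h2
    · rw [h.1 i hi, h'.1 i hi]

theorem coeff_one_add_X_pow_add_symm {n k : ℕ} {g : ℤ} (hg : n < 2 → g = 0) (hk : k ≤ n) :
    ((1 + X) ^ n + C g * X * (1 + X) ^ (n - 2) : ℤ[X]).coeff (n - k) =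
      ((1 + X) ^ n + C g * X * (1 + X) ^ (n - 2) : ℤ[X]).coeff k := by
  rw [mul_assoc, coeff_add, coeff_add, coeff_C_mul, coeff_C_mul, coeff_one_add_X_pow,
    coeff_one_add_X_pow, Nat.choose_symm hk]
  congr 1
  rcases lt_or_ge n 2 with hn | hn
  · simp [hg hn]
  congr 1
  rcases Nat.eq_zero_or_pos k with rfl | hk0
  · obtain ⟨n, rfl⟩ := Nat.exists_eq_add_of_le' hn
    rw [coeff_X_mul_zero, show n + 2 - 0 = n + 1 + 1 by omega, coeff_X_mul, coeff_one_add_X_pow,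
      Nat.choose_eq_zero_of_lt (by omega)]
    simp
  rcases eq_or_lt_of_le hk with rfl | hkn
  · obtain ⟨k, rfl⟩ := Nat.exists_eq_add_of_le' hn
    rw [Nat.sub_self, coeff_X_mul_zero, show k + 2 = k + 1 + 1 by omega, coeff_X_mul,
      coeff_one_add_X_pow, Nat.choose_eq_zero_of_lt (by omega)]
    simp
  obtain ⟨k, rfl⟩ := Nat.exists_eq_add_of_le' hk0
  rw [show n - (k + 1) = n - 2 - k + 1 by omega, coeff_X_mul, coeff_X_mul, coeff_one_add_X_pow,
    coeff_one_add_X_pow, Nat.choose_symm (by omega)]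

/-- If the reversed `h`-polynomial is `(1 + t)^n + g t (1 + t)^{n-2}`, then so is the
`h`-polynomial, this polynomial being palindromic. -/
theorem isGammaVector_of_shiftedFPolynomial_eq {K : SimplicialComplexOn V} {g : ℤ}
    (hg : K.rank < 2 → g = 0)
    (hK : K.shiftedFPolynomial = (1 + X) ^ K.rank + C g * X * (1 + X) ^ (K.rank - 2)) :
    K.IsGammaVector fun i => if i = 0 then 1 else if i = 1 then g else 0 := by
  constructor
  · intro i hi
    have hi0 : i ≠ 0 := by omega
    simp only [hi0, if_false, ite_eq_right_iff]
    exact fun h => hg (by omega)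
  have hdeg : K.shiftedFPolynomial.natDegree < K.rank + 1 := by
    rw [hK, Nat.lt_succ_iff]
    have hpow : ∀ n, ((1 + X : ℤ[X]) ^ n).natDegree ≤ n := fun n => by
      refine natDegree_pow_le_of_le n (?_ : (1 + X : ℤ[X]).natDegree ≤ 1) |>.trans (by simp)
      compute_degree
    refine natDegree_add_le_of_degree_le (hpow _) ?_
    rcases lt_or_ge K.rank 2 with hn | hn
    · simp [hg hn]
    · refine (natDegree_mul_le_of_le ((natDegree_C_mul_le g X).trans natDegree_X_le)
        (hpow _)).trans ?_
      omega
  have hleft : ∑ k : Fin (K.rank + 1), C (K.hVector k) * X ^ (k : ℕ) = K.shiftedFPolynomial := by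
    conv_rhs => rw [as_sum_range_C_mul_X_pow' _ hdeg]
    rw [← Fin.sum_univ_eq_sum_range]
    refine Finset.sum_congr rfl fun k _ => ?_
    rw [hVector, hK, coeff_one_add_X_pow_add_symm hg (Nat.lt_succ_iff.1 k.2)]
  rw [hleft, hK, Finset.sum_range_succ']
  rcases lt_or_ge K.rank 2 with hn | hn
  · have : K.rank / 2 = 0 := by omega
    simp [this, hg hn]
  · obtain ⟨q, hq⟩ : ∃ q, K.rank / 2 = q + 1 := ⟨K.rank / 2 - 1, by omega⟩
    rw [hq, Finset.sum_range_succ', Finset.sum_eq_zero]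
    · simp
      ring
    · intro i _
      simp

theorem fVector_zero (K : SimplicialComplexOn V) : K.fVector 0 = 1 := by
  rw [fVector, Set.ncard_eq_one]
  refine ⟨∅, Set.ext fun s => ?_⟩
  simp only [Set.mem_ofPred_eq, Finset.card_eq_zero, Set.mem_singleton_iff]
  exact ⟨fun h => h.2, fun h => ⟨h ▸ K.empty_mem, h⟩⟩

/-- Comparison of the coefficients of `t^{n-1}` in the definition of the `h`-vector. -/
theorem eq_fVector_one_sub_of_shiftedFPolynomial_eq {K : SimplicialComplexOn V} {g : ℤ}
    (hn : 2 ≤ K.rank)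
    (hK : K.shiftedFPolynomial = (1 + X) ^ K.rank + C g * X * (1 + X) ^ (K.rank - 2)) :
    g = K.fVector 1 - 2 * K.rank := by
  obtain ⟨n, hn'⟩ := Nat.exists_eq_add_of_le' hn
  have h := congrArg (fun p => coeff p (n + 1)) hK
  simp only [shiftedFPolynomial, hn'] at h
  rw [Finset.sum_range_succ', Finset.sum_range_succ', coeff_add, coeff_add, finsetSum_coeff,
    Finset.sum_eq_zero, coeff_C_mul, coeff_C_mul] at h
  · have h1 : ((X - 1 : ℤ[X]) ^ (n + 1)).coeff (n + 1) = 1 := by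
      have : (X - 1 : ℤ[X]) = X + C (-1) := by simp [sub_eq_add_neg]
      rw [this, coeff_X_add_C_pow]
      simp
    have h2 : ((X - 1 : ℤ[X]) ^ (n + 2)).coeff (n + 1) = -(n + 2) := by
      have : (X - 1 : ℤ[X]) = X + C (-1) := by simp [sub_eq_add_neg]
      rw [this, coeff_X_add_C_pow, show n + 2 - (n + 1) = 1 by omega]
      simp
      ring
    have h3 : ((1 + X : ℤ[X]) ^ (n + 2)).coeff (n + 1) = n + 2 := by
      rw [coeff_one_add_X_pow]
      simp
      ring
    have h4 : (C g * X * (1 + X : ℤ[X]) ^ n).coeff (n + 1) = g := by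
      rw [mul_assoc, coeff_C_mul, coeff_X_mul, coeff_one_add_X_pow]
      simp
    rw [show n + 2 - (0 + 1) = n + 1 by omega, Nat.sub_zero, h1, h2, fVector_zero,
      Nat.add_sub_cancel, coeff_add, h3, h4] at h
    rw [hn']
    push_cast at h ⊢
    linarith
  · intro i _
    rw [coeff_C_mul]
    refine mul_eq_zero_of_right _ (coeff_eq_zero_of_natDegree_lt ?_)
    have : (X - 1 : ℤ[X]) = X - C 1 := by simp
    rw [this]
    refine (natDegree_pow_le_of_le _ (natDegree_X_sub_C_le 1)).trans_lt ?_
    omega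

/-- The complex of `N` isolated points. -/
def isolatedPoints (N : ℕ) : SimplicialComplexOn (Fin N) where
  faces := {s | s.card ≤ 1}
  empty_mem := by simp
  down_closed := fun _ _ hs hts => (Finset.card_le_card hts).trans hs

theorem isFlag_isolatedPoints (N : ℕ) : (isolatedPoints N).IsFlag := by
  intro s hs
  have hcard : ¬ s.card ≤ 1 := hs.prop
  obtain ⟨t, hts, ht⟩ := Finset.exists_subset_card_eq (show 2 ≤ s.card by omega)
  have htn : t ∉ (isolatedPoints N).faces := fun h => by
    have : t.card ≤ 1 := h
    omega
  exact ht ▸ Finset.card_le_card (hs.le_of_le htn hts)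

theorem fVector_isolatedPoints (N i : ℕ) :
    (isolatedPoints N).fVector i = if i = 0 then 1 else if i = 1 then N else 0 := by
  rcases Nat.lt_or_ge i 2 with hi | hi
  · interval_cases i
    · simp [fVector_zero]
    · have : {s : Finset (Fin N) | s ∈ (isolatedPoints N).faces ∧ s.card = 1}
          = ((Finset.univ.powersetCard 1 : Finset (Finset (Fin N))) : Set (Finset (Fin N))) := by
        ext s
        simp only [Set.mem_ofPred_eq, Finset.mem_coe, Finset.mem_powersetCard_univ]
        exact ⟨fun h => h.2, fun h => ⟨h.le, h⟩⟩
      rw [fVector, this, Set.ncard_coe_finset]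
      simp
  · rw [if_neg (by omega), if_neg (by omega), fVector, Set.ncard_eq_zero (Set.toFinite _)]
    refine Set.eq_empty_of_forall_notMem fun s hs => ?_
    have : s.card ≤ 1 := hs.1
    have := hs.2
    omega

end SimplicialComplexOn

/-! ### The `h`-polynomial of a flag Murai sphere -/

namespace Multicomplex

variable {m : ℕ} {c : Fin m → ℕ}

open Classical in
/-- The `c`-monomials outside `M` in the essential variables. -/
noncomputable def essentialOutside (M : Multicomplex c) : Finset (Fin m → ℕ) :=
  M.outside.filter fun v => ∀ i, ¬ M.IsEssential i → v i = 0

open Classical in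
/-- The generating function of the complement of `M` has a factor `x + y` for every inessential
variable. -/
theorem sum_outside_eq {M : Multicomplex c} (hM : M.HasSmallGenerators)
    (hc : ∀ i, ¬ M.IsEssential i → c i = 1) {R : Type*} [CommSemiring R] (x y : R) :
    ∑ v ∈ M.outside, x ^ (∑ i, v i) * y ^ (∑ i, (c i - v i)) =
      (x + y) ^ (Finset.univ.filter fun i => ¬ M.IsEssential i).card *
        ∑ w ∈ M.essentialOutside,
          x ^ (∑ i, w i) * y ^ (∑ i with M.IsEssential i, (c i - w i)) := by
  rw [← Finset.sum_pow_mul_eq_add_pow, Finset.sum_mul_sum, ← Finset.sum_product']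
  refine Finset.sum_bij' (fun v _ => (Finset.univ.filter fun i => ¬ M.IsEssential i ∧ v i = 1,
      fun i => if M.IsEssential i then v i else 0))
    (fun p _ i => if M.IsEssential i then p.2 i else if i ∈ p.1 then 1 else 0) ?_ ?_ ?_ ?_ ?_
  · intro v hv
    obtain ⟨hvc, hvM⟩ := mem_outside.1 hv
    rw [Finset.mem_product, Finset.mem_powerset, essentialOutside, Finset.mem_filter, mem_outside]
    refine ⟨fun i hi => ?_, ⟨fun i => ?_, hM.essential_part_notMem hvc hvM⟩, fun i hi => if_neg hi⟩
    · simp only [Finset.mem_filter] at hi ⊢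
      exact ⟨hi.1, hi.2.1⟩
    · dsimp only
      split_ifs
      · exact hvc i
      · exact Nat.zero_le _
  · rintro ⟨S, w⟩ hp
    rw [Finset.mem_product, Finset.mem_powerset, essentialOutside, Finset.mem_filter,
      mem_outside] at hp
    obtain ⟨hS, ⟨hwc, hwM⟩, hw⟩ := hp
    refine mem_outside.2 ⟨fun i => ?_, fun h => hwM (M.down_closed h fun i => ?_)⟩
    · dsimp only
      split_ifs with h
      · exact hwc i
      · exact (hc i h).ge
      · exact Nat.zero_le _
    · by_cases hi : M.IsEssential i
      · simp [hi]
      · exact (hw i hi).trans_le (Nat.zero_le _)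
  · intro v hv
    funext i
    have h1 : v i ≤ c i := (mem_outside.1 hv).1 i
    by_cases hi : M.IsEssential i
    · simp [hi]
    · rw [hc i hi] at h1
      simp only [hi, if_false, Finset.mem_filter, Finset.mem_univ, true_and, not_false_eq_true]
      split_ifs <;> omega
  · rintro ⟨S, w⟩ hp
    rw [Finset.mem_product, Finset.mem_powerset, essentialOutside, Finset.mem_filter] at hp
    obtain ⟨hS, -, hw⟩ := hp
    refine Prod.ext ?_ ?_
    · ext i
      have hSi : i ∈ S → ¬ M.IsEssential i := fun h => (Finset.mem_filter.1 (hS h)).2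
      by_cases hi : M.IsEssential i <;> by_cases hiS : i ∈ S <;> simp_all
    · funext i
      by_cases hi : M.IsEssential i
      · simp [hi]
      · simpa [hi] using (hw i hi).symm
  · intro v hv
    -- Both exponents are sums over the essential and the inessential variables.
    have hv1 : ∀ i, ¬ M.IsEssential i → v i = if v i = 1 then 1 else 0 := by
      intro i hi
      have : v i ≤ c i := (mem_outside.1 hv).1 i
      rw [hc i hi] at this
      split_ifs <;> omega
    have hS : (Finset.univ.filter fun i => ¬ M.IsEssential i ∧ v i = 1).card
        = ∑ i with ¬ M.IsEssential i, v i := by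
      rw [← Finset.filter_filter, Finset.card_filter]
      exact Finset.sum_congr rfl fun i hi => (hv1 i (Finset.mem_filter.1 hi).2).symm
    have hJ : (Finset.univ.filter fun i => ¬ M.IsEssential i).card
        = ∑ i with ¬ M.IsEssential i, v i + ∑ i with ¬ M.IsEssential i, (c i - v i) := by
      rw [← Finset.sum_add_distrib, Finset.card_eq_sum_ones]
      refine Finset.sum_congr rfl fun i hi => ?_
      have : v i ≤ c i := (mem_outside.1 hv).1 i
      have := hc i (Finset.mem_filter.1 hi).2
      omega
    have hx : ∑ i, v i = ∑ i with ¬ M.IsEssential i, v i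
        + ∑ i, if M.IsEssential i then v i else 0 := by
      rw [← Finset.sum_filter, add_comm, Finset.sum_filter_add_sum_filter_not]
    have hy : ∑ i, (c i - v i) = ∑ i with ¬ M.IsEssential i, (c i - v i)
        + ∑ i with M.IsEssential i, (c i - if M.IsEssential i then v i else 0) := by
      rw [Finset.sum_congr (s₁ := Finset.univ.filter M.IsEssential) rfl fun i hi => by
        rw [if_pos (Finset.mem_filter.1 hi).2], add_comm, Finset.sum_filter_add_sum_filter_not]
    rw [hS, hJ, Nat.add_sub_cancel_left, hx, hy, pow_add, pow_add]
    ring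

open Classical in
/-- The number of `c`-monomials of degree `j` in the essential variables outside `M`. -/
noncomputable def essentialCount (M : Multicomplex c) (j : ℕ) : ℕ :=
  (M.essentialOutside.filter fun w => ∑ i, w i = j).card

open Classical in
theorem essentialCount_zero (M : Multicomplex c) : M.essentialCount 0 = 0 := by
  rw [essentialCount, Finset.card_eq_zero, Finset.filter_eq_empty_iff]
  intro w hw h0
  rw [essentialOutside, Finset.mem_filter, mem_outside] at hw
  have : w = 0 := funext fun i => (Finset.sum_eq_zero_iff.1 h0) i (Finset.mem_univ i)
  exact hw.1.2 (this ▸ M.zero_mem)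

open Classical in
theorem sum_essential_eq {M : Multicomplex c} {w : Fin m → ℕ} (hw : w ∈ M.essentialOutside) :
    ∑ i with M.IsEssential i, w i = ∑ i, w i := by
  refine Finset.sum_filter_of_ne fun i _ hi => ?_
  by_contra h
  exact hi ((Finset.mem_filter.1 hw).2 i h)

open Classical in
/-- The only `c`-monomial of top degree in the essential variables is the essential part of
`x^c`, which is outside `M`. -/
theorem essentialCount_sum_bound {M : Multicomplex c} (hM : M.IsProper)
    (hgen : M.HasSmallGenerators) : M.essentialCount (∑ i with M.IsEssential i, c i) = 1 := by
  rw [essentialCount, Finset.card_eq_one]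
  refine ⟨fun i => if M.IsEssential i then c i else 0, Finset.ext fun w => ?_⟩
  rw [Finset.mem_filter, Finset.mem_singleton]
  constructor
  · rintro ⟨hw, hsum⟩
    have hw' := hw
    rw [← sum_essential_eq hw] at hsum
    rw [essentialOutside, Finset.mem_filter, mem_outside] at hw'
    have := (Finset.sum_eq_sum_iff_of_le fun i _ => hw'.1.1 i).1 hsum
    funext i
    split_ifs with hi
    · exact this i (by simpa using hi)
    · exact hw'.2 i hi
  · rintro rfl
    refine ⟨Finset.mem_filter.2 ⟨mem_outside.2 ⟨fun i => ?_,
      hgen.essential_part_notMem le_rfl (not_bound_mem hM)⟩, fun i hi => if_neg hi⟩, ?_⟩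
    · dsimp only
      split_ifs
      · exact le_rfl
      · exact Nat.zero_le _
    · rw [Finset.sum_filter]

open Classical in
theorem sum_essentialOutside_eq (M : Multicomplex c) {R : Type*} [CommSemiring R] (x y : R) :
    ∑ w ∈ M.essentialOutside, x ^ (∑ i, w i) * y ^ (∑ i with M.IsEssential i, (c i - w i)) =
      ∑ j ∈ Finset.range (∑ i with M.IsEssential i, c i + 1),
        (M.essentialCount j : R) * (x ^ j * y ^ (∑ i with M.IsEssential i, c i - j)) := by
  have hle : ∀ w ∈ M.essentialOutside, w ≤ c := fun w hw =>
    (mem_outside.1 (Finset.mem_filter.1 hw).1).1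
  rw [← Finset.sum_fiberwise_of_maps_to (g := fun w => ∑ i, w i)
    (t := Finset.range (∑ i with M.IsEssential i, c i + 1))]
  · refine Finset.sum_congr rfl fun j _ => ?_
    rw [essentialCount, ← nsmul_eq_mul, ← Finset.sum_const]
    refine Finset.sum_congr rfl fun w hw => ?_
    obtain ⟨hwM, rfl⟩ := Finset.mem_filter.1 hw
    rw [Finset.sum_tsub_distrib _ fun i _ => hle w hwM i, sum_essential_eq hwM]
  · intro w hw
    rw [Finset.mem_range, Nat.lt_succ_iff, ← sum_essential_eq hw]
    exact Finset.sum_le_sum fun i _ => hle w hw i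

open Polynomial in
/-- The reversed `h`-polynomial of a flag Murai sphere is `(1 + t)^n + g t (1 + t)^{n-2}`: it is
a power of `1 + t` times a palindromic polynomial of degree at most three. -/
theorem exists_shiftedFPolynomial_bier_eq (hc : ∀ i, 0 < c i) {M : Multicomplex c}
    {hM : M.IsProper} (hflag : (M.bier hM).IsFlag) :
    ∃ g : ℤ, ((M.bier hM).rank < 2 → g = 0) ∧ (M.bier hM).shiftedFPolynomial =
      (1 + X) ^ (M.bier hM).rank + C g * X * (1 + X) ^ ((M.bier hM).rank - 2) := by
  classical
  have hgen := hasSmallGenerators_of_isFlag hflag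
  have hone : ∀ i, ¬ M.IsEssential i → c i = 1 := fun i =>
    bound_eq_one_of_not_isEssential hc hflag
  have hfour := (hasSmallCodegree_of_isFlag hflag).sum_bound_le_four
  have htop := essentialCount_sum_bound hM hgen
  have hbot := M.essentialCount_zero
  have hrank : (M.bier hM).rank + 1 = ∑ i with M.IsEssential i, c i
      + (Finset.univ.filter fun i => ¬ M.IsEssential i).card := by
    rw [rank_bier_add_one, ← Finset.sum_filter_add_sum_filter_not _ M.IsEssential,
      Finset.card_eq_sum_ones]
    exact congrArg _ (Finset.sum_congr rfl fun i hi => hone i (Finset.mem_filter.1 hi).2)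
  have h1 := sum_outside_eq hgen hone (X : ℤ[X]) 1
  have h2 := sum_outside_eq hgen hone 1 (X : ℤ[X])
  rw [sum_essentialOutside_eq] at h1 h2
  simp only [one_pow, one_mul, mul_one] at h1 h2
  have hF := mul_shiftedFPolynomial_bier M hM
  rw [h1, h2] at hF
  clear h1 h2
  generalize (Finset.univ.filter fun i => ¬ M.IsEssential i).card = k at *
  generalize ∑ i with M.IsEssential i, c i = D at *
  generalize (M.bier hM).shiftedFPolynomial = F at *
  generalize (M.bier hM).rank = n at *
  have hX : (X - 1 : ℤ[X]) ≠ 0 := by simpa using X_sub_C_ne_zero (1 : ℤ)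
  -- `D = 0` is impossible, since the coefficient would be zero and one.
  interval_cases D
  · omega
  · obtain rfl : n = k := by omega
    refine ⟨0, fun _ => rfl, mul_left_cancel₀ hX (hF.trans ?_)⟩
    simp only [Finset.sum_range_succ, Finset.sum_range_zero, htop, hbot]
    simp
    ring
  · obtain rfl : n = k + 1 := by omega
    refine ⟨0, fun _ => rfl, mul_left_cancel₀ hX (hF.trans ?_)⟩
    simp only [Finset.sum_range_succ, Finset.sum_range_zero, htop, hbot]
    simp
    ring
  · obtain rfl : n = k + 2 := by omega
    refine ⟨M.essentialCount 2 - M.essentialCount 1 - 1, fun h => by omega,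
      mul_left_cancel₀ hX (hF.trans ?_)⟩
    simp only [Finset.sum_range_succ, Finset.sum_range_zero, htop, hbot]
    simp
    ring
  · obtain rfl : n = k + 3 := by omega
    refine ⟨M.essentialCount 3 - M.essentialCount 1 - 2, fun h => by omega,
      mul_left_cancel₀ hX (hF.trans ?_)⟩
    simp only [Finset.sum_range_succ, Finset.sum_range_zero, htop, hbot,
      show k + 3 - 2 = k + 1 by omega]
    simp
    ring

end Multicomplex

theorem mainTheorem3 (m : ℕ) (c : Fin m → ℕ) (hc : ∀ i, 0 < c i) (M : Multicomplex c)
    (hM : M.IsProper) (hflag : (M.bier hM).IsFlag) :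
    (∃! γ : ℕ → ℤ, (M.bier hM).IsGammaVector γ) ∧
      ∀ γ : ℕ → ℤ, (M.bier hM).IsGammaVector γ →
        ∃ (N : ℕ) (L : SimplicialComplexOn (Fin N)),
          L.IsFlag ∧ ∀ i : ℕ, (L.fVector i : ℤ) = γ i := by
  obtain ⟨g, hg, hF⟩ := Multicomplex.exists_shiftedFPolynomial_bier_eq hc hflag
  have hγ := SimplicialComplexOn.isGammaVector_of_shiftedFPolynomial_eq hg hF
  have hg0 : 0 ≤ g := by
    rcases lt_or_ge (M.bier hM).rank 2 with hn | hn
    · exact (hg hn).ge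
    · rw [SimplicialComplexOn.eq_fVector_one_sub_of_shiftedFPolynomial_eq hn hF]
      have := Multicomplex.two_mul_rank_le_fVector_one hflag
      omega
  refine ⟨⟨_, hγ, fun γ h => h.unique hγ⟩, fun γ h => ?_⟩
  obtain ⟨N, rfl⟩ := Int.eq_ofNat_of_zero_le hg0
  refine ⟨N, SimplicialComplexOn.isolatedPoints N, SimplicialComplexOn.isFlag_isolatedPoints N,
    fun i => ?_⟩
  rw [h.unique hγ, SimplicialComplexOn.fVector_isolatedPoints]
  dsimp only
  split_ifs <;> simp
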